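/- Let $F$ be a finitary endofunctor and $(T,\eta^T,\mu^T)$ a finitary monad on $\mathsf{Set}$ (finitary: preserving filtered colimits), and let $\rho\colon TF\to FT$ be a functor-over-monad distributive law, i.e. a natural transformation with $\rho\cdot\eta^TF=F\eta^T$ and $\rho\cdot\mu^TF=F\mu^T\cdot\rho T\cdot T\rho$. Let $\hat F$ be the induced lifting of $F$ to the category $\mathsf{Set}^T$ of Eilenberg--Moore algebras, $\hat F(A,a)=(FA,\,Fa\cdot\rho_A)$. *Extension semantics.* For an $FT$-coalgebra $\gamma\colon X\to FTX$ let $D(\gamma)=F\mu^T_X\cdot\rho_{TX}\cdot T\gamma\colon TX\to \hat FTX$, an $\hat F$-coalgebra on the free $T$-algebra $TX$. A final $F$-coalgebra $Z$ carries a unique $T$-algebra structure making it an $\hat F$-coalgebra, and it is then a final $\hat F$-coalgebra. The extension semantics of $\gamma$ is the composite of $\eta^T_X\colon X\to TX$ with the unique $\hat F$-coalgebra morphism $TX\to Z$ from $D(\gamma)$. Let $1$ be the final $T$-algebra, let $\bar\gamma_0={!}_{TX}\colon TX\to 1$ and $\bar\gamma_{n+1}=\hat F\bar\gamma_n\cdot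 D(\gamma)\colon TX\to\hat F^{n+1}1$. *Trace semantics.* Let $\hat F^*$, with unit $\hat\eta$, be the free monad on $\hat F$, given by free $\hat F$-algebras with structure maps $\hat\varphi_A\colon\hat F\hat F^*A\to\hat F^*A$. Let $\hat\kappa=\hat\varphi\cdot\hat F\hat\eta\colon\hat F\to\hat F^*$, and let $\hat\beta^n\colon\hat F^n\to\hat F^*$ be given by $\hat\beta^0=\hat\eta$, $\hat\beta^{n+1}=\hat\varphi\cdot\hat F\hat\beta^n$. Put $\hat\gamma_n=\hat\beta^n_1\cdot\bar\gamma_n\colon TX\to\hat F^*1$. Let $M=\hat F^*T$ be the monad on $\mathsf{Set}$ of the composite adjunction $\mathsf{Set}\rightleftarrows\mathsf{Set}^T\rightleftarrows\mathsf{Alg}\,\hat F$, with unit $\eta^M$ and Kleisli star $f^*=\mu^M\cdot Mf$, and let $\alpha=\hat\kappa T\colon FT\to M$. For $\gamma\colon X\to FTX$ put $\gamma^{(0)}=\eta^M_X$ and $\gamma^{(n+1)}=(\alpha_X\gamma)^*\gamma^{(n)}$; the $\alpha$-trace sequence of $x\in X$ is $\big(M{!}_X\,\gamma^{(n)}(x)\big)_{n<\omega}$,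 a sequence in $M1$, where ${!}_X\colon X\to 1$. **Theorem.** A final $F$-coalgebra and free $\hat F$-algebras on all $T$-algebras exist, and, for any choice of these, the following hold. 1. For every $\gamma\colon X\to FTX$ and every $n<\omega$, $$\hat\gamma_n\cdot\eta^T_X=\hat F^*{!}_{T1}\cdot M{!}_X\cdot\gamma^{(n)}.$$ 2. Let $x\in X$ and $y\in Y$ be states in $FT$-coalgebras $\gamma\colon X\to FTX$ and $\delta\colon Y\to FTY$. If $x$ and $y$ have the same extension semantics, then their $\alpha$-trace sequences become equal after componentwise postcomposition with $\hat F^*{!}_{T1}\colon M1\to\hat F^*1$. 3. If coproduct injections are monic in $\mathsf{Set}^T$, then the converse of 2 holds as well: $x$ and $y$ have the same extension semantics if and only if their $\alpha$-trace sequences become equal after componentwise postcomposition with $\hat F^*{!}_{T1}$. -/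

import Mathlib

open CategoryTheory CategoryTheory.Limits

universe u

namespace TraceSem

/-! ## Trace semantics in a global monad -/

section Trace

variable {G : Type u ⥤ Type u} {M : Monad (Type u)}

/-- The unique map `! : X → 1`. -/
def bang (X : Type u) : X ⟶ PUnit.{u + 1} :=
  TypeCat.ofHom fun _ => PUnit.unit

/-- The Kleisli star `f ↦ f^* = μ · M f` of a monad. -/
def kleisliStar (M : Monad (Type u)) {X Y : Type u} (f : X ⟶ M.obj Y) : M.obj X ⟶ M.obj Y :=
  M.map f ≫ M.μ.app Y

/-- The iterations `γ^(0) = η_X`, `γ^(n+1) = (α γ)^* γ^(n)` of a `G`-coalgebra `γ`. -/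
def iteration (α : G ⟶ M.toFunctor) {X : Type u} (γ : X ⟶ G.obj X) : ℕ → (X ⟶ M.obj X)
  | 0 => M.η.app X
  | n + 1 => iteration α γ n ≫ kleisliStar M (γ ≫ α.app X)

/-- The `α`-trace sequence `(M! (γ^(n) (x)))_n` of a state `x` in a `G`-coalgebra `γ`. -/
def traceSeq (α : G ⟶ M.toFunctor) {X : Type u} (γ : X ⟶ G.obj X) (x : X) (n : ℕ) :
    M.obj PUnit.{u + 1} :=
  (iteration α γ n ≫ M.map (bang X)) x

end Trace

/-! ## Distributive laws and the lifting of `F` to Eilenberg-Moore algebras -/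

/-- A functor-over-monad distributive law `ρ : TF → FT`. -/
structure DistribLaw (F : Type u ⥤ Type u) (T : Monad (Type u)) where
  /-- The underlying natural transformation. -/
  ρ : F ⋙ T.toFunctor ⟶ T.toFunctor ⋙ F
  /-- Compatibility with the unit: `ρ_X · η_{FX} = F η_X`. -/
  unit : ∀ X : Type u, T.η.app (F.obj X) ≫ ρ.app X = F.map (T.η.app X)
  /-- Compatibility with the multiplication: `ρ_X · μ_{FX} = F μ_X · ρ_{TX} · T ρ_X`. -/
  mult : ∀ X : Type u, T.μ.app (F.obj X) ≫ ρ.app X =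
    T.map (ρ.app X) ≫ ρ.app (T.obj X) ≫ F.map (T.μ.app X)

variable {F : Type u ⥤ Type u} {T : Monad (Type u)}

namespace DistribLaw

variable (D : DistribLaw F T)

theorem naturality {X Y : Type u} (f : X ⟶ Y) :
    T.map (F.map f) ≫ D.ρ.app Y = D.ρ.app X ≫ F.map (T.map f) :=
  D.ρ.naturality f

/-- The lifting `F̂` of `F` to `Set^T`: `F̂ (A, a) = (F A, F a · ρ_A)`. -/
def lift : T.Algebra ⥤ T.Algebra where
  obj A :=
    { A := F.obj A.A
      a := D.ρ.app A.A ≫ F.map A.a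
      unit := by
        rw [← Category.assoc, D.unit, ← F.map_comp, A.unit]
        exact F.map_id _
      assoc := by
        rw [← Category.assoc, D.mult, Functor.map_comp]
        simp only [Category.assoc]
        rw [← Category.assoc (T.map (F.map A.a)), D.naturality]
        simp only [Category.assoc, ← F.map_comp, A.assoc] }
  map {A B} f :=
    { f := F.map f.f
      h := by
        change T.map (F.map f.f) ≫ D.ρ.app B.A ≫ F.map B.a =
          (D.ρ.app A.A ≫ F.map A.a) ≫ F.map f.f
        rw [← Category.assoc, D.naturality]
        simp only [Category.assoc, ← F.map_comp, f.h] }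
  map_id A := by ext1; exact F.map_id _
  map_comp f g := by ext1; exact F.map_comp _ _

/-! ## Extension semantics (generalized powerset construction) -/

/-- The `T`-algebra morphism `D(γ) = F μ_X · ρ_{TX} · T γ : TX → F̂ TX`. -/
def determinizeHom {X : Type u} (γ : X ⟶ F.obj (T.obj X)) :
    T.free.obj X ⟶ D.lift.obj (T.free.obj X) where
  f := T.map γ ≫ D.ρ.app (T.obj X) ≫ F.map (T.μ.app X)
  h := by
    change T.map (T.map γ ≫ D.ρ.app (T.obj X) ≫ F.map (T.μ.app X)) ≫
        D.ρ.app (T.obj X) ≫ F.map (T.μ.app X) =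
      T.μ.app X ≫ T.map γ ≫ D.ρ.app (T.obj X) ≫ F.map (T.μ.app X)
    have hμ : T.μ.app X ≫ T.map γ = T.map (T.map γ) ≫ T.μ.app (F.obj (T.obj X)) :=
      (T.μ.naturality γ).symm
    rw [← Category.assoc (T.μ.app X), hμ, Category.assoc, ← Category.assoc (T.μ.app _),
      D.mult]
    simp only [Functor.map_comp, Category.assoc]
    rw [← Category.assoc (T.map (F.map (T.μ.app X))), D.naturality]
    simp only [Category.assoc, ← F.map_comp, T.assoc]

/-- The `F̂`-coalgebra `D(γ)` on the free `T`-algebra `TX`. -/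
def determinize {X : Type u} (γ : X ⟶ F.obj (T.obj X)) : Endofunctor.Coalgebra D.lift where
  V := T.free.obj X
  str := D.determinizeHom γ

/-- The `F`-coalgebra `ρ_V · T ζ : TV → FTV` obtained from an `F`-coalgebra `ζ : V → FV`. -/
def applyT (V : Endofunctor.Coalgebra F) : Endofunctor.Coalgebra F where
  V := T.obj V.V
  str := T.map V.str ≫ D.ρ.app V.V

/-- `T` acts on `F`-coalgebra morphisms. -/
def applyTMap {V W : Endofunctor.Coalgebra F} (f : V ⟶ W) : D.applyT V ⟶ D.applyT W where
  f := T.map f.f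
  h := by
    change (T.map V.str ≫ D.ρ.app V.V) ≫ F.map (T.map f.f) =
      T.map f.f ≫ T.map W.str ≫ D.ρ.app W.V
    rw [Category.assoc, ← D.naturality, ← Category.assoc, ← Category.assoc, ← T.map_comp,
      ← T.map_comp, f.h]

/-- The unit of `T` is a coalgebra morphism. -/
def applyTUnit (V : Endofunctor.Coalgebra F) : V ⟶ D.applyT V where
  f := T.η.app V.V
  h := by
    change V.str ≫ F.map (T.η.app V.V) = T.η.app V.V ≫ T.map V.str ≫ D.ρ.app V.V
    have h : T.η.app V.V ≫ T.map V.str = V.str ≫ T.η.app (F.obj V.V) :=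
      (T.η.naturality V.str).symm
    rw [← Category.assoc, h, Category.assoc, D.unit]

/-- The multiplication of `T` is a coalgebra morphism. -/
def applyTMult (V : Endofunctor.Coalgebra F) : D.applyT (D.applyT V) ⟶ D.applyT V where
  f := T.μ.app V.V
  h := by
    change (T.map (T.map V.str ≫ D.ρ.app V.V) ≫ D.ρ.app (T.obj V.V)) ≫ F.map (T.μ.app V.V) =
      T.μ.app V.V ≫ T.map V.str ≫ D.ρ.app V.V
    have h : T.μ.app V.V ≫ T.map V.str = T.map (T.map V.str) ≫ T.μ.app (F.obj V.V) :=
      (T.μ.naturality V.str).symm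
    have hm := congrArg (fun g => T.map (T.map V.str) ≫ g) (D.mult V.V)
    rw [← Category.assoc (T.μ.app V.V), h, Category.assoc]
    refine Eq.trans ?_ hm.symm
    simp only [Functor.map_comp, Category.assoc]

variable {Z : Endofunctor.Coalgebra F} (hZ : IsTerminal Z)

/-- The `T`-algebra structure on the carrier of a final `F`-coalgebra `Z`, given by the unique
`F`-coalgebra morphism `TZ → Z`. -/
def finalAlgebra : T.Algebra where
  A := Z.V
  a := (hZ.from (D.applyT Z)).f
  unit := congrArg Endofunctor.Coalgebra.Hom.f
    (hZ.hom_ext (D.applyTUnit Z ≫ hZ.from (D.applyT Z)) (𝟙 Z))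
  assoc := congrArg Endofunctor.Coalgebra.Hom.f
    (hZ.hom_ext (D.applyTMult Z ≫ hZ.from (D.applyT Z))
      (D.applyTMap (hZ.from (D.applyT Z)) ≫ hZ.from (D.applyT Z)))

/-- The `F̂`-coalgebra carried by a final `F`-coalgebra `Z`. -/
def finalCoalgebra : Endofunctor.Coalgebra D.lift where
  V := D.finalAlgebra hZ
  str :=
    { f := Z.str
      h := by
        change T.map Z.str ≫ D.ρ.app Z.V ≫ F.map (hZ.from (D.applyT Z)).f =
          (hZ.from (D.applyT Z)).f ≫ Z.str
        rw [← Category.assoc]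
        exact (hZ.from (D.applyT Z)).h }

/-- The underlying `F`-coalgebra of an `F̂`-coalgebra. -/
def underlying (V : Endofunctor.Coalgebra D.lift) : Endofunctor.Coalgebra F where
  V := V.V.A
  str := V.str.f

/-- The structure map of the `T`-algebra carrying an `F̂`-coalgebra is an `F`-coalgebra
morphism. -/
def algebraStr (V : Endofunctor.Coalgebra D.lift) :
    D.applyT (D.underlying V) ⟶ D.underlying V where
  f := V.V.a
  h := by
    exact (Category.assoc _ _ _).trans V.str.h

/-- The `F̂`-coalgebra on a final `F`-coalgebra is final. -/
def finalCoalgebraIsTerminal : IsTerminal (D.finalCoalgebra hZ) :=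
  IsTerminal.ofUniqueHom
    (fun V =>
      { f :=
          { f := (hZ.from (D.underlying V)).f
            h := congrArg Endofunctor.Coalgebra.Hom.f
              (hZ.hom_ext (D.applyTMap (hZ.from (D.underlying V)) ≫ hZ.from (D.applyT Z))
                (D.algebraStr V ≫ hZ.from (D.underlying V))) }
        h := by
          ext1
          exact (hZ.from (D.underlying V)).h })
    (fun V m => by
      ext1
      ext1
      exact congrArg Endofunctor.Coalgebra.Hom.f
        (hZ.hom_ext
          (show D.underlying V ⟶ Z from
            { f := m.f.f
              h := congrArg Monad.Algebra.Hom.f m.h })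
          (hZ.from (D.underlying V))))

/-- The extension semantics `X → TX → Z` of an `FT`-coalgebra `γ : X → FTX`: the unique
`F̂`-coalgebra morphism from `D(γ)` to the final `F̂`-coalgebra, precomposed with `η_X`. -/
def extensionSemantics {X : Type u} (γ : X ⟶ F.obj (T.obj X)) : X ⟶ Z.V :=
  T.η.app X ≫ ((D.finalCoalgebraIsTerminal hZ).from (D.determinize γ)).f.f

/-! ## The final sequence of `F̂` -/

/-- The one-element `T`-algebra `1`, which is final in `Set^T`. -/
def one (T : Monad (Type u)) : T.Algebra where
  A := PUnit.{u + 1}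
  a := bang _

/-- The unique `T`-algebra morphism `!_A : A → 1`. -/
def toOne (A : T.Algebra) : A ⟶ one T where
  f := bang A.A

/-- The iterates `F̂^n`. -/
def iterLift : ℕ → (T.Algebra ⥤ T.Algebra)
  | 0 => 𝟭 _
  | n + 1 => iterLift n ⋙ D.lift

/-- The canonical cone `γ̄_n : TX → F̂^n 1` of the `F̂`-coalgebra `D(γ)`. -/
def cone {X : Type u} (γ : X ⟶ F.obj (T.obj X)) :
    (n : ℕ) → (T.free.obj X ⟶ (D.iterLift n).obj (one T))
  | 0 => toOne (T.free.obj X)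
  | n + 1 => D.determinizeHom γ ≫ D.lift.map (cone γ n)

/-! ## The free monad on `F̂` and the global monad `M`

Here `L` is any left adjoint of the forgetful functor `Alg F̂ → Set^T`, so that `L A` is a free
`F̂`-algebra on `A`. -/

variable {D} {L : T.Algebra ⥤ Endofunctor.Algebra D.lift}
  (adj : L ⊣ Endofunctor.Algebra.forget D.lift)

/-- The free monad `F̂^*` on `F̂`. -/
abbrev freeMonad : Monad T.Algebra := adj.toMonad

/-- The structure `φ̂_A : F̂ F̂^* A → F̂^* A` of the free `F̂`-algebra on `A`. -/
def freeStr (A : T.Algebra) : D.lift.obj ((freeMonad adj).obj A) ⟶ (freeMonad adj).obj A :=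
  (L.obj A).str

theorem freeStr_naturality {A B : T.Algebra} (f : A ⟶ B) :
    D.lift.map ((freeMonad adj).map f) ≫ freeStr adj B =
      freeStr adj A ≫ (freeMonad adj).map f :=
  (L.map f).h

/-- The universal natural transformation `κ̂ = φ̂ · F̂ η̂ : F̂ → F̂^*`. -/
def kappa : D.lift ⟶ (freeMonad adj).toFunctor where
  app A := D.lift.map ((freeMonad adj).η.app A) ≫ freeStr adj A
  naturality A B f := by
    have h : f ≫ (freeMonad adj).η.app B =
        (freeMonad adj).η.app A ≫ (freeMonad adj).map f :=
      (freeMonad adj).η.naturality f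
    rw [Category.assoc, ← freeStr_naturality, ← Category.assoc, ← Category.assoc,
      ← D.lift.map_comp, ← D.lift.map_comp, h]

/-- The natural transformations `β̂^n : F̂^n → F̂^*` (componentwise): `β̂^0 = η̂` and
`β̂^{n+1} = φ̂ · F̂ β̂^n`. -/
def beta : (n : ℕ) → (A : T.Algebra) → ((D.iterLift n).obj A ⟶ (freeMonad adj).obj A)
  | 0, A => (freeMonad adj).η.app A
  | n + 1, A => D.lift.map (beta n A) ≫ freeStr adj A

/-- The maps `γ̂_n = β̂^n_1 · γ̄_n : TX → F̂^* 1`. -/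
def gammaHat {X : Type u} (γ : X ⟶ F.obj (T.obj X)) (n : ℕ) :
    T.free.obj X ⟶ (freeMonad adj).obj (one T) :=
  D.cone γ n ≫ beta adj n (one T)

/-- The monad `M = F̂^* T` of the composite adjunction `Set ⇄ Set^T ⇄ Alg F̂`. -/
abbrev globalMonad : Monad (Type u) := (T.adj.comp adj).toMonad

/-- The trace semantics `α = κ̂ T : FT → M`. -/
def alpha : T.toFunctor ⋙ F ⟶ (globalMonad adj).toFunctor where
  app X := ((kappa adj).app (T.free.obj X)).f
  naturality _ _ f :=
    congrArg Monad.Algebra.Hom.f ((kappa adj).naturality (T.free.map f))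

/-- The map `F̂^* !_{T1} : M 1 → F̂^* 1`. -/
def collapse : (globalMonad adj).obj PUnit.{u + 1} ⟶ ((freeMonad adj).obj (one T)).A :=
  ((freeMonad adj).map (toOne (T.free.obj PUnit.{u + 1}))).f

end DistribLaw

end TraceSem

/-!
The proof rests on two concrete descriptions and one formal fact.

*Finite behaviours determine the extension semantics.* A finitary functor `F` preserves jointly
injective sequences of maps `p n : E ⟶ P n` out of a nonempty set `E` that become finer and finer,
because an element of `F E` comes from a finite subset of `E`, on which a single `p n` is injective
(`eq_of_forall_map_eq`).
Applied to the projections of the set of all behaviour sequences in `∏ n, F^n 1` realized by states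
of coalgebras, this gives that set a coalgebra structure, which is final
(`Behaviours.coalgebraIsTerminal`). So states of a final coalgebra with the same finite behaviours
are equal, and the extension semantics of `x` is determined by the elements `γ̄_n (η x)`
(`DistribLaw.extensionSemantics_eq_iff`).

*Free `F̂`-algebras.* As `F` and `T` are finitary, every element generated by a `T`-algebra `A` in an
`F̂`-algebra is the value of a term with finitary operations. Terms modulo equality of their values
in all `F̂`-algebras form the free `F̂`-algebra on `A` (`isRightAdjoint_forget`).

*Traces.* The iterations `γ^(n)` satisfy `γ^(n+1) = (γ^(n))^* · α · γ`, and the Kleisli star of `M` is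
transposition along the composite adjunction. Hence the extension of `γ^(n)` to `TX` obeys the
recursion that defines `γ̂_n`, with `F̂^* 1` replaced by `F̂^* T X`, and naturality gives the identity
`DistribLaw.unit_comp_gammaHat`. It says that the `n`-th member of the collapsed trace sequence of `x`
is `β̂^n (γ̄_n (η x))`, so equal extension semantics imply equal collapsed traces.

For the converse, `β̂^n` has to be injective. A free `F̂`-algebra `F̂^* A` is the coproduct of
`F̂ F̂^* A` and `A` with injections `φ̂` and `η̂` (`nonempty_isColimit_of_free`). When coproduct
injections are monic, induction on `n` shows that `β̂^n` is injective (`DistribLaw.injective_beta`).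
-/

namespace TraceSem

/-! ### Finitary endofunctors of sets -/

section Finitary

/-- The diagram of the finite subsets of `X`, ordered by inclusion. -/
def finsetDiagram (X : Type u) : Finset X ⥤ Type u where
  obj s := s
  map f := TypeCat.ofHom fun x => ⟨x.1, leOfHom f x.2⟩

/-- The cocone exhibiting `X` as the union of its finite subsets. -/
def finsetCocone (X : Type u) : Cocone (finsetDiagram X) where
  pt := X
  ι := { app s := TypeCat.ofHom Subtype.val }

/-- Every set is the filtered colimit of its finite subsets. -/
theorem nonempty_isColimit_finsetCocone (X : Type u) :
    Nonempty (IsColimit (finsetCocone X)) := by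
  refine ⟨Types.FilteredColimit.isColimitOf' _ _ (fun x => ?_) (fun s x y h => ?_)⟩
  · exact ⟨{x}, ⟨x, Finset.mem_singleton_self x⟩, rfl⟩
  · exact ⟨s, 𝟙 s, congrArg _ (Subtype.ext h)⟩

variable (F : Type u ⥤ Type u)

section

variable [PreservesFilteredColimits F]

theorem exists_map_finset_eq {X : Type u} (t : F.obj X) :
    ∃ (s : Finset X) (t' : F.obj s),
      F.map (TypeCat.ofHom (Subtype.val : s → X)) t' = t := by
  obtain ⟨h⟩ := nonempty_isColimit_finsetCocone X
  obtain ⟨s, t', ht⟩ :=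
    Types.jointly_surjective_of_isColimit (isColimitOfPreserves F h) t
  exact ⟨s, t', ht⟩

/-- Variant of `exists_map_finset_eq` in which the supports range over a fixed set of finite types. -/
theorem exists_map_fin_eq {X : Type u} (t : F.obj X) :
    ∃ (n : ℕ) (i : ULift.{u} (Fin n) → X) (t' : F.obj (ULift.{u} (Fin n))),
      F.map (TypeCat.ofHom i) t' = t := by
  obtain ⟨s, t', rfl⟩ := exists_map_finset_eq F t
  refine ⟨s.card, fun k => s.equivFin.symm k.down,
    F.map (TypeCat.ofHom fun x => ULift.up (s.equivFin x)) t', ?_⟩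
  rw [← Functor.map_comp_apply]
  have h : (TypeCat.ofHom fun x : s => ULift.up.{u} (s.equivFin x)) ≫
      TypeCat.ofHom (fun k => (s.equivFin.symm k.down : X)) = TypeCat.ofHom Subtype.val := by
    ext x
    simp
  rw [h]

end

/-- Enlarging the finite set that supports an element of `F X`. -/
theorem exists_map_finset_eq_of_subset {X : Type u} {s s' : Finset X} (h : s ⊆ s')
    (t : F.obj s) : ∃ t' : F.obj s', F.map (TypeCat.ofHom (Subtype.val : s' → X)) t' =
      F.map (TypeCat.ofHom (Subtype.val : s → X)) t :=
  ⟨F.map (TypeCat.ofHom fun x => ⟨x.1, h x.2⟩) t, by rw [← Functor.map_comp_apply]; rfl⟩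

/-- Injections with nonempty domain are split, so every functor preserves them. This can fail for
an empty domain. -/
theorem map_injective_of_injective {X Y : Type u} [Nonempty X] (f : X ⟶ Y)
    (hf : Function.Injective f) : Function.Injective (F.map f) := by
  have h : f ≫ TypeCat.ofHom (Function.invFun f) = 𝟙 X := by
    ext x
    exact Function.leftInverse_invFun hf x
  refine Function.LeftInverse.injective (g := F.map (TypeCat.ofHom (Function.invFun f))) ?_
  intro x
  rw [← Functor.map_comp_apply, h, F.map_id, types_id_apply]

/-- A finitary functor preserves jointly injective sequences of maps out of a nonempty set, when
these become finer and finer: on a finite set of arguments some map of the sequence is already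
injective. -/
theorem eq_of_forall_map_eq [PreservesFilteredColimits F] {E : Type u} [Nonempty E]
    {P : ℕ → Type u} (p : (n : ℕ) → E ⟶ P n)
    (hmono : ∀ n x y, p (n + 1) x = p (n + 1) y → p n x = p n y)
    (hinj : ∀ x y, (∀ n, p n x = p n y) → x = y) {t t' : F.obj E}
    (h : ∀ n, F.map (p n) t = F.map (p n) t') : t = t' := by
  classical
  obtain ⟨s₁, t₁, rfl⟩ := exists_map_finset_eq F t
  obtain ⟨s₂, t₂, rfl⟩ := exists_map_finset_eq F t'
  obtain ⟨e⟩ := ‹Nonempty E›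
  -- the point `e` makes the common support nonempty
  let s : Finset E := insert e (s₁ ∪ s₂)
  have hs₁ : s₁ ⊆ s := fun x hx => by simp [s, hx]
  have hs₂ : s₂ ⊆ s := fun x hx => by simp [s, hx]
  obtain ⟨u₁, hu₁⟩ := exists_map_finset_eq_of_subset F hs₁ t₁
  obtain ⟨u₂, hu₂⟩ := exists_map_finset_eq_of_subset F hs₂ t₂
  rw [← hu₁, ← hu₂] at h ⊢
  have : Nonempty s := ⟨⟨e, by simp [s]⟩⟩
  have hle : ∀ m n, m ≤ n → ∀ x y, p n x = p n y → p m x = p m y := by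
    intro m n hmn
    induction n, hmn using Nat.le_induction with
    | base => exact fun x y hxy => hxy
    | succ n _ ih => exact fun x y hxy => ih x y (hmono n x y hxy)
  obtain ⟨N, hN⟩ : ∃ N, ∀ x y : s, p N x = p N y → x = y := by
    have hex : ∀ q : s × s, ∃ n, p n q.1 = p n q.2 → q.1 = q.2 := by
      intro q
      by_contra! hq
      exact (hq 0).2 (Subtype.ext (hinj _ _ fun n => (hq n).1))
    choose N hN using hex
    refine ⟨Finset.univ.sup N, fun x y hxy => hN (x, y) (hle _ _ ?_ _ _ hxy)⟩
    exact Finset.le_sup (f := N) (Finset.mem_univ (x, y))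
  have hinjN : Function.Injective (F.map (TypeCat.ofHom (Subtype.val : s → E) ≫ p N)) :=
    map_injective_of_injective F _ fun x y hxy => hN x y hxy
  have hN' := h N
  rw [← Functor.map_comp_apply, ← Functor.map_comp_apply] at hN'
  rw [hinjN hN']

end Finitary

/-! ### The final sequence and the final coalgebra -/

section FinalSequence

variable (F : Type u ⥤ Type u)

/-- The objects `F^n 1` of the final sequence of `F`. -/
def finalSeq : ℕ → Type u
  | 0 => PUnit.{u + 1}
  | n + 1 => F.obj (finalSeq n)

/-- The connecting maps `F^{n+1} 1 → F^n 1` of the final sequence of `F`. -/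
def finalSeqMap : (n : ℕ) → (finalSeq F (n + 1) ⟶ finalSeq F n)
  | 0 => bang _
  | n + 1 => F.map (finalSeqMap n)

variable {F}

/-- The canonical cone of a coalgebra `c` over the final sequence: `behaviour c n x` is the
behaviour of the state `x` observed for `n` steps. -/
def behaviour {X : Type u} (c : X ⟶ F.obj X) : (n : ℕ) → (X ⟶ finalSeq F n)
  | 0 => bang X
  | n + 1 => c ≫ F.map (behaviour c n)

theorem behaviour_comp_finalSeqMap {X : Type u} (c : X ⟶ F.obj X) (n : ℕ) :
    behaviour c (n + 1) ≫ finalSeqMap F n = behaviour c n := by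
  induction n with
  | zero => rfl
  | succ n ih =>
    change (c ≫ F.map (behaviour c (n + 1))) ≫ F.map (finalSeqMap F n) = c ≫ F.map _
    rw [Category.assoc, ← F.map_comp, ih]

theorem comp_behaviour {X Y : Type u} {c : X ⟶ F.obj X} {d : Y ⟶ F.obj Y} (f : X ⟶ Y)
    (hf : c ≫ F.map f = f ≫ d) (n : ℕ) : f ≫ behaviour d n = behaviour c n := by
  induction n with
  | zero => rfl
  | succ n ih =>
    change f ≫ d ≫ F.map (behaviour d n) = c ≫ F.map (behaviour c n)
    rw [← Category.assoc, ← hf, Category.assoc, ← F.map_comp, ih]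

theorem behaviour_hom_apply {V W : Endofunctor.Coalgebra F} (f : V ⟶ W) (n : ℕ) (x : V.V) :
    behaviour W.str n (f.f x) = behaviour V.str n x :=
  ConcreteCategory.congr_hom (comp_behaviour f.f f.h n) x

variable (F)

/-- The sequences of finite behaviours that are realized by a state of some coalgebra. They form
a subset of the product of the `F^n 1`, hence a set, although all coalgebras are considered. -/
def Behaviours : Type u :=
  { s : (n : ℕ) → finalSeq F n //
    ∃ (X : Type u) (c : X ⟶ F.obj X) (x : X), s = fun n => behaviour c n x }

namespace Behaviours

variable {F}

/-- The map from a coalgebra sending a state to its sequence of finite behaviours. -/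
def ofState {X : Type u} (c : X ⟶ F.obj X) : X ⟶ Behaviours F :=
  TypeCat.ofHom fun x => ⟨fun n => behaviour c n x, X, c, x, rfl⟩

/-- The projection to the behaviour observed for `n` steps. -/
def proj (n : ℕ) : Behaviours F ⟶ finalSeq F n :=
  TypeCat.ofHom fun s => s.1 n

theorem ofState_proj {X : Type u} (c : X ⟶ F.obj X) (n : ℕ) :
    ofState c ≫ proj n = behaviour c n := rfl

variable [PreservesFilteredColimits F]

theorem map_eq_of_forall_proj [Nonempty (Behaviours F)] {t t' : F.obj (Behaviours F)}
    (h : ∀ n, F.map (proj n) t = F.map (proj n) t') : t = t' := by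
  refine eq_of_forall_map_eq F proj ?_ ?_ h
  · rintro n ⟨_, X, c, x, rfl⟩ ⟨_, Y, d, y, rfl⟩ hxy
    have hx := ConcreteCategory.congr_hom (behaviour_comp_finalSeqMap c n) x
    have hy := ConcreteCategory.congr_hom (behaviour_comp_finalSeqMap d n) y
    exact hx.symm.trans ((congrArg (finalSeqMap F n) hxy).trans hy)
  · exact fun x y hxy => Subtype.ext (funext hxy)

/-- The successor structure of a realized behaviour, taken from a state that realizes it. -/
noncomputable def str : Behaviours F ⟶ F.obj (Behaviours F) :=
  TypeCat.ofHom fun s =>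
    F.map (ofState s.2.choose_spec.choose)
      (s.2.choose_spec.choose s.2.choose_spec.choose_spec.choose)

/-- The structure map does not depend on the realizing state, since the finite behaviours
determine it. -/
theorem ofState_str {X : Type u} (c : X ⟶ F.obj X) :
    ofState c ≫ str = c ≫ F.map (ofState c) := by
  ext x
  let s : Behaviours F := ofState c x
  have : Nonempty (Behaviours F) := ⟨s⟩
  refine map_eq_of_forall_proj fun n => ?_
  have hs := congrFun s.2.choose_spec.choose_spec.choose_spec (n + 1)
  change F.map (proj n) (F.map (ofState s.2.choose_spec.choose)
      (s.2.choose_spec.choose s.2.choose_spec.choose_spec.choose)) =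
    F.map (proj n) (F.map (ofState c) (c x))
  rw [← Functor.map_comp_apply, ← Functor.map_comp_apply, ofState_proj, ofState_proj]
  exact hs.symm

variable (F) in
/-- The coalgebra of realized behaviours. -/
noncomputable def coalgebra : Endofunctor.Coalgebra F where
  V := Behaviours F
  str := str

theorem behaviour_str (n : ℕ) : behaviour (str (F := F)) n = proj n := by
  ext s
  obtain ⟨_, X, c, x, rfl⟩ := s
  exact ConcreteCategory.congr_hom (comp_behaviour (ofState c) (ofState_str c).symm n) x

variable (F) in
/-- The coalgebra of realized behaviours is final. -/
noncomputable def coalgebraIsTerminal : IsTerminal (coalgebra F) :=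
  IsTerminal.ofUniqueHom
    (fun V => { f := ofState V.str, h := (ofState_str V.str).symm })
    (fun V m => by
      ext x
      refine Subtype.ext (funext fun n => ?_)
      have h := behaviour_hom_apply m n x
      change behaviour str n (m.f x) = _ at h
      rw [behaviour_str] at h
      exact h)

end Behaviours

/-- The states of a final coalgebra of a finitary functor are separated by their finite
behaviours. -/
theorem eq_of_behaviour_eq [PreservesFilteredColimits F] {Z : Endofunctor.Coalgebra F}
    (hZ : IsTerminal Z) {z z' : Z.V}
    (h : ∀ n, behaviour Z.str n z = behaviour Z.str n z') : z = z' := by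
  let f := (Behaviours.coalgebraIsTerminal F).from Z
  let g := hZ.from (Behaviours.coalgebra F)
  have hfg : ∀ z, g.f (f.f z) = z := fun z =>
    ConcreteCategory.congr_hom
      (congrArg Endofunctor.Coalgebra.Hom.f (hZ.hom_ext (f ≫ g) (𝟙 Z))) z
  rw [← hfg z, ← hfg z']
  exact congrArg g.f (Subtype.ext (funext h))

end FinalSequence

/-! ### Free algebras of the lifting, as classes of terms -/

section FreeAlgebra

/-- Terms over the variables `A` whose operations are the elements of `F n` and of `T n`, for
finite sets `n`. -/
inductive Term (F T : Type u ⥤ Type u) (A : Type u) : Type u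
  | var (a : A) : Term F T A
  | opF (n : ℕ) (t : F.obj (ULift.{u} (Fin n))) (k : ULift.{u} (Fin n) → Term F T A) : Term F T A
  | opT (n : ℕ) (t : T.obj (ULift.{u} (Fin n))) (k : ULift.{u} (Fin n) → Term F T A) : Term F T A

variable {F : Type u ⥤ Type u} {T : Monad (Type u)} {D : DistribLaw F T} {A : T.Algebra}

/-- The `F`-algebra structure underlying an `F̂`-algebra. -/
def setStr (B : Endofunctor.Algebra D.lift) : F.obj B.a.A ⟶ B.a.A := B.str.f

theorem map_setStr (B : Endofunctor.Algebra D.lift) :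
    T.map (setStr B) ≫ B.a.a = D.ρ.app B.a.A ≫ F.map B.a.a ≫ setStr B :=
  B.str.h.trans (Category.assoc _ _ _)

/-- The value of a term in an `F̂`-algebra `B`, under the valuation `f` of the variables. -/
def Term.eval (B : Endofunctor.Algebra D.lift) (f : A ⟶ B.a) :
    Term F T.toFunctor A.A → B.a.A
  | .var a => f.f a
  | .opF _ t k => setStr B (F.map (TypeCat.ofHom fun i => (k i).eval B f) t)
  | .opT _ t k => B.a.a (T.map (TypeCat.ofHom fun i => (k i).eval B f) t)

variable (D A)

/-- Two terms are identified when they have the same value in all `F̂`-algebras, under all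
valuations that are `T`-algebra morphisms. -/
def termSetoid : Setoid (Term F T.toFunctor A.A) where
  r w w' := ∀ (B : Endofunctor.Algebra D.lift) (f : A ⟶ B.a), w.eval B f = w'.eval B f
  iseqv := ⟨fun _ _ _ => rfl, fun h B f => (h B f).symm,
    fun h h' B f => (h B f).trans (h' B f)⟩

/-- The carrier of the free `F̂`-algebra on the `T`-algebra `A`. -/
def FreeCarrier : Type u := Quotient (termSetoid D A)

namespace FreeCarrier

variable {D A}

/-- The class of a term. -/
def mk (w : Term F T.toFunctor A.A) : FreeCarrier D A := Quotient.mk (termSetoid D A) w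

/-- The valuation of classes of terms in an `F̂`-algebra. -/
def eval (B : Endofunctor.Algebra D.lift) (f : A ⟶ B.a) : FreeCarrier D A ⟶ B.a.A :=
  TypeCat.ofHom (Quotient.lift (Term.eval B f) fun _ _ h => h B f)

theorem ext_of_eval {q q' : FreeCarrier D A}
    (h : ∀ (B : Endofunctor.Algebra D.lift) (f : A ⟶ B.a), eval B f q = eval B f q') :
    q = q' := by
  induction q using Quotient.inductionOn
  induction q' using Quotient.inductionOn
  exact Quotient.sound h

/-- The valuations are jointly monic. All equations that the free algebra has to satisfy follow
from their validity in the algebras `B`. -/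
theorem hom_ext_of_eval {Y : Type u} {g g' : Y ⟶ FreeCarrier D A}
    (h : ∀ (B : Endofunctor.Algebra D.lift) (f : A ⟶ B.a), g ≫ eval B f = g' ≫ eval B f) :
    g = g' := by
  ext y
  exact ext_of_eval fun B f => ConcreteCategory.congr_hom (h B f) y

/-- The insertion of variables. -/
def var : A.A ⟶ FreeCarrier D A :=
  TypeCat.ofHom fun a => mk (.var a)

theorem var_eval (B : Endofunctor.Algebra D.lift) (f : A ⟶ B.a) : var ≫ eval B f = f.f := rfl

theorem exists_rep {n : ℕ} (i : ULift.{u} (Fin n) → FreeCarrier D A) :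
    ∃ k : ULift.{u} (Fin n) → Term F T.toFunctor A.A, i = fun j => mk (k j) :=
  ⟨fun j => (i j).out, funext fun j => (Quotient.out_eq (i j)).symm⟩

/-- Every element of `F Q`, for `Q` the set of classes of terms, comes from a finite tuple of classes;
representing terms of these are the arguments of an operation of `F`. -/
theorem exists_strF [PreservesFilteredColimits F] (t : F.obj (FreeCarrier D A)) :
    ∃ q : FreeCarrier D A, ∀ (B : Endofunctor.Algebra D.lift) (f : A ⟶ B.a),
      eval B f q = setStr B (F.map (eval B f) t) := by
  obtain ⟨n, i, t', rfl⟩ := exists_map_fin_eq F t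
  obtain ⟨k, rfl⟩ := exists_rep i
  refine ⟨mk (.opF n t' k), fun B f => ?_⟩
  rw [← Functor.map_comp_apply]
  rfl

theorem exists_strT [PreservesFilteredColimits T.toFunctor] (t : T.obj (FreeCarrier D A)) :
    ∃ q : FreeCarrier D A, ∀ (B : Endofunctor.Algebra D.lift) (f : A ⟶ B.a),
      eval B f q = B.a.a (T.map (eval B f) t) := by
  obtain ⟨n, i, t', rfl⟩ := exists_map_fin_eq T.toFunctor t
  obtain ⟨k, rfl⟩ := exists_rep i
  refine ⟨mk (.opT n t' k), fun B f => ?_⟩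
  rw [← Functor.map_comp_apply]
  rfl

/-- The `F`-algebra structure on classes of terms. -/
noncomputable def strF [PreservesFilteredColimits F] :
    F.obj (FreeCarrier D A) ⟶ FreeCarrier D A :=
  TypeCat.ofHom fun t => (exists_strF t).choose

/-- The `T`-algebra structure on classes of terms. -/
noncomputable def strT [PreservesFilteredColimits T.toFunctor] :
    T.obj (FreeCarrier D A) ⟶ FreeCarrier D A :=
  TypeCat.ofHom fun t => (exists_strT t).choose

theorem strF_eval [PreservesFilteredColimits F] (B : Endofunctor.Algebra D.lift)
    (f : A ⟶ B.a) : strF ≫ eval B f = F.map (eval B f) ≫ setStr B := by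
  ext t
  exact (exists_strF t).choose_spec B f

theorem strT_eval [PreservesFilteredColimits T.toFunctor] (B : Endofunctor.Algebra D.lift)
    (f : A ⟶ B.a) : strT ≫ eval B f = T.map (eval B f) ≫ B.a.a := by
  ext t
  exact (exists_strT t).choose_spec B f

theorem mk_opF [PreservesFilteredColimits F] (n : ℕ) (t : F.obj (ULift.{u} (Fin n)))
    (k : ULift.{u} (Fin n) → Term F T.toFunctor A.A) :
    mk (.opF n t k) = strF (F.map (TypeCat.ofHom fun i => mk (D := D) (A := A) (k i)) t) := by
  refine ext_of_eval fun B f => ?_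
  rw [← types_comp_apply strF (eval B f), strF_eval, types_comp_apply, ← Functor.map_comp_apply]
  rfl

theorem mk_opT [PreservesFilteredColimits T.toFunctor] (n : ℕ)
    (t : T.obj (ULift.{u} (Fin n))) (k : ULift.{u} (Fin n) → Term F T.toFunctor A.A) :
    mk (.opT n t k) = strT (T.map (TypeCat.ofHom fun i => mk (D := D) (A := A) (k i)) t) := by
  refine ext_of_eval fun B f => ?_
  rw [← types_comp_apply strT (eval B f), strT_eval, types_comp_apply, ← Functor.map_comp_apply]
  rfl

end FreeCarrier

variable [PreservesFilteredColimits F] [PreservesFilteredColimits T.toFunctor]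

open FreeCarrier

/-- The `T`-algebra of classes of terms. -/
noncomputable def freeTAlgebra : T.Algebra where
  A := FreeCarrier D A
  a := strT
  unit := by
    refine hom_ext_of_eval fun B f => ?_
    have hη := T.η.naturality (eval B f)
    simp only [Functor.id_map, Functor.id_obj] at hη
    rw [Category.assoc, strT_eval, ← Category.assoc, ← hη, Category.assoc, B.a.unit]
    rfl
  assoc := by
    refine hom_ext_of_eval fun B f => ?_
    have hμ : T.map (T.map (eval B f)) ≫ T.μ.app _ = T.μ.app _ ≫ T.map (eval B f) :=
      T.μ.naturality (eval B f)
    rw [Category.assoc, Category.assoc, strT_eval, ← Category.assoc, ← hμ, Category.assoc,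
      B.a.assoc, ← Category.assoc, ← Category.assoc, ← T.map_comp, ← T.map_comp, strT_eval]

/-- The free `F̂`-algebra on the `T`-algebra `A`: classes of terms. -/
noncomputable def freeAlgebra : Endofunctor.Algebra D.lift where
  a := freeTAlgebra D A
  str :=
    { f := strF
      h := by
        change T.map strF ≫ strT = (D.ρ.app _ ≫ F.map strT) ≫ strF
        refine hom_ext_of_eval fun B f => ?_
        simp only [Category.assoc]
        rw [strT_eval, strF_eval, ← Category.assoc, ← T.map_comp, strF_eval, T.map_comp,
          Category.assoc, map_setStr, ← Category.assoc, D.naturality, Category.assoc,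
          ← Category.assoc (F.map _), ← F.map_comp, ← Category.assoc (F.map _), ← F.map_comp,
          strT_eval] }

/-- The universal `T`-algebra morphism into the free `F̂`-algebra. -/
noncomputable def freeUnit : A ⟶ (freeAlgebra D A).a where
  f := var
  h := by
    change T.map var ≫ strT = A.a ≫ var
    refine hom_ext_of_eval fun B f => ?_
    rw [Category.assoc, Category.assoc, strT_eval, ← Category.assoc, ← T.map_comp, var_eval,
      f.h]

variable {D A}

/-- The extension of a `T`-algebra morphism `f` to the free `F̂`-algebra. -/
noncomputable def freeLift (B : Endofunctor.Algebra D.lift) (f : A ⟶ B.a) :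
    freeAlgebra D A ⟶ B where
  f :=
    { f := eval B f
      h := (strT_eval B f).symm }
  h := by
    ext1
    exact (strF_eval B f).symm

theorem freeUnit_comp_freeLift (B : Endofunctor.Algebra D.lift) (f : A ⟶ B.a) :
    freeUnit D A ≫ (freeLift B f).f = f := rfl

theorem eq_freeLift (B : Endofunctor.Algebra D.lift) (f : A ⟶ B.a) (m : freeAlgebra D A ⟶ B)
    (hm : freeUnit D A ≫ m.f = f) : m = freeLift B f := by
  have hF (t : F.obj (FreeCarrier D A)) : m.f.f (strF t) = setStr B (F.map m.f.f t) :=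
    (ConcreteCategory.congr_hom (congrArg Monad.Algebra.Hom.f m.h) t).symm
  have hT (t : T.obj (FreeCarrier D A)) : m.f.f (strT t) = B.a.a (T.map m.f.f t) :=
    (ConcreteCategory.congr_hom m.f.h t).symm
  have key (w : Term F T.toFunctor A.A) : m.f.f (FreeCarrier.mk w) = w.eval B f := by
    induction w with
    | var a => exact ConcreteCategory.congr_hom (congrArg Monad.Algebra.Hom.f hm) a
    | opF n t k ih =>
      rw [mk_opF, hF]
      refine congrArg (setStr B) ?_
      refine (Functor.map_comp_apply _ _ _ _).symm.trans ?_
      exact congrArg (fun g => F.map (TypeCat.ofHom g) t) (funext ih)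
    | opT n t k ih =>
      rw [mk_opT, hT]
      refine congrArg B.a.a ?_
      refine (Functor.map_comp_apply _ _ _ _).symm.trans ?_
      exact congrArg (fun g => T.map (TypeCat.ofHom g) t) (funext ih)
  ext q
  induction q using Quotient.inductionOn with
  | h w => exact key w

variable (D) in
theorem isRightAdjoint_forget : (Endofunctor.Algebra.forget D.lift).IsRightAdjoint := by
  have (A : T.Algebra) :
      HasInitial (StructuredArrow A (Endofunctor.Algebra.forget D.lift)) := by
    let I : StructuredArrow A (Endofunctor.Algebra.forget D.lift) :=
      StructuredArrow.mk (Y := freeAlgebra D A) (freeUnit D A)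
    refine (IsInitial.ofUniqueHom (X := I)
      (fun B => StructuredArrow.homMk (freeLift B.right B.hom)
        (freeUnit_comp_freeLift _ _)) fun B m => ?_).hasInitial
    ext1
    exact eq_freeLift B.right B.hom m.right (StructuredArrow.w m)
  exact isRightAdjointOfStructuredArrowInitials _

end FreeAlgebra

/-! ### A free algebra as a coproduct -/

section Lambek

variable {C : Type*} [Category* C] [HasBinaryProducts C] {H : C ⥤ C}

/-- The algebra on the product of an algebra `I` and an object `B` whose second component is given
by a morphism `f : H I ⟶ B`. -/
noncomputable def prodAlgebra (I : Endofunctor.Algebra H) {B : C} (f : H.obj I.a ⟶ B) :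
    Endofunctor.Algebra H where
  a := I.a ⨯ B
  str := prod.lift (H.map prod.fst ≫ I.str) (H.map prod.fst ≫ f)

/-- The first projection, which is an algebra morphism. -/
noncomputable def prodAlgebraFst (I : Endofunctor.Algebra H) {B : C} (f : H.obj I.a ⟶ B) :
    prodAlgebra I f ⟶ I where
  f := prod.fst
  h := (prod.lift_fst _ _).symm

/-- The second projection. -/
noncomputable def prodAlgebraSnd (I : Endofunctor.Algebra H) {B : C} (f : H.obj I.a ⟶ B) :
    (prodAlgebra I f).a ⟶ B :=
  prod.snd

theorem prodAlgebra_str_comp_snd (I : Endofunctor.Algebra H) {B : C} (f : H.obj I.a ⟶ B) :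
    (prodAlgebra I f).str ≫ prodAlgebraSnd I f = H.map (prodAlgebraFst I f).f ≫ f :=
  prod.lift_snd _ _

/-- A morphism `h` with `I.str ≫ h = f` is a section of the first projection of
`prodAlgebra I f`. -/
noncomputable def prodAlgebraLift {I : Endofunctor.Algebra H} {B : C} (f : H.obj I.a ⟶ B)
    (h : I.a ⟶ B) (hf : I.str ≫ h = f) : I ⟶ prodAlgebra I f where
  f := prod.lift (𝟙 _) h
  h := by
    change H.map (prod.lift (𝟙 _) h) ≫ prod.lift _ _ = I.str ≫ prod.lift (𝟙 _) h
    have hfst : H.map (prod.lift (𝟙 I.a) h) ≫ H.map prod.fst = 𝟙 _ := by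
      rw [← H.map_comp, prod.lift_fst, H.map_id]
    rw [prod.comp_lift, prod.comp_lift, ← Category.assoc, hfst, ← Category.assoc, hfst,
      Category.id_comp, Category.id_comp, Category.comp_id, hf]

/-- A free algebra `I` on `A`, with universal morphism `i`, is the coproduct of `H I` and `A`. The
copairing of `f : H I ⟶ B` and `g : A ⟶ B` is the second component of an algebra morphism
`I ⟶ I × B`; no coproduct has to exist beforehand. -/
theorem nonempty_isColimit_of_free (I : Endofunctor.Algebra H) {A : C} (i : A ⟶ I.a)
    (hom_ext : ∀ {B : Endofunctor.Algebra H} (k k' : I ⟶ B), i ≫ k.f = i ≫ k'.f → k = k')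
    (exists_hom : ∀ (B : Endofunctor.Algebra H) (g : A ⟶ B.a), ∃ k : I ⟶ B, i ≫ k.f = g) :
    Nonempty (IsColimit (BinaryCofan.mk I.str i)) := by
  have key {B : C} (f : H.obj I.a ⟶ B) (g : A ⟶ B) :
      ∃ h : I.a ⟶ B, I.str ≫ h = f ∧ i ≫ h = g := by
    obtain ⟨k, hk⟩ := exists_hom (prodAlgebra I f) (prod.lift i g)
    have hk₁ : i ≫ k.f ≫ (prodAlgebraFst I f).f = i := by
      rw [← Category.assoc, hk]
      exact prod.lift_fst _ _
    have hk₂ : i ≫ k.f ≫ prodAlgebraSnd I f = g := by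
      rw [← Category.assoc, hk]
      exact prod.lift_snd _ _
    have hkf : k.f ≫ (prodAlgebraFst I f).f = 𝟙 _ :=
      congrArg Endofunctor.Algebra.Hom.f
        (hom_ext (k ≫ prodAlgebraFst I f) (𝟙 I) (hk₁.trans (Category.comp_id _).symm))
    refine ⟨k.f ≫ prodAlgebraSnd I f, ?_, hk₂⟩
    rw [← Category.assoc, ← k.h, Category.assoc, prodAlgebra_str_comp_snd, ← Category.assoc,
      ← H.map_comp, hkf, H.map_id, Category.id_comp]
  have uniq {B : C} (f : H.obj I.a ⟶ B) (h h' : I.a ⟶ B) (hf : I.str ≫ h = f)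
      (hf' : I.str ≫ h' = f) (hg : i ≫ h = i ≫ h') : h = h' := by
    have hk : prodAlgebraLift f h hf = prodAlgebraLift f h' hf' := hom_ext _ _ (by
      change i ≫ prod.lift _ _ = i ≫ prod.lift _ _
      rw [prod.comp_lift, prod.comp_lift, hg])
    have hk' : prod.lift (𝟙 _) h = prod.lift (𝟙 _) h' :=
      congrArg Endofunctor.Algebra.Hom.f hk
    rw [← prod.lift_snd (𝟙 I.a) h, hk', prod.lift_snd]
  exact ⟨BinaryCofan.IsColimit.mk _ (fun f g => (key f g).choose)
    (fun f g => (key f g).choose_spec.1) (fun f g => (key f g).choose_spec.2)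
    (fun f g m hf hg => uniq f _ _ hf (key f g).choose_spec.1
      (hg.trans (key f g).choose_spec.2.symm))⟩

theorem nonempty_isColimit_of_adjunction {L : C ⥤ Endofunctor.Algebra H}
    (adj : L ⊣ Endofunctor.Algebra.forget H) (A : C) :
    Nonempty (IsColimit (BinaryCofan.mk (L.obj A).str (adj.unit.app A))) := by
  refine nonempty_isColimit_of_free (L.obj A) (adj.unit.app A) (fun k k' h => ?_) fun B g => ?_
  · refine (adj.homEquiv A _).injective ?_
    rw [Adjunction.homEquiv_unit, Adjunction.homEquiv_unit]
    exact h
  · refine ⟨(adj.homEquiv A B).symm g, ?_⟩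
    have h := (adj.homEquiv A B).apply_symm_apply g
    rwa [Adjunction.homEquiv_unit] at h

end Lambek

namespace DistribLaw

variable {F : Type u ⥤ Type u} {T : Monad (Type u)} {D : DistribLaw F T}

/-! ### The canonical cone and the extension semantics -/

section FinalSequence

variable (D) in
/-- The comparison of `F̂^n 1` with the final sequence of `F`. -/
def iterLiftToFinalSeq : (n : ℕ) → (((D.iterLift n).obj (one T)).A ⟶ finalSeq F n)
  | 0 => 𝟙 PUnit
  | n + 1 => F.map (iterLiftToFinalSeq n)

theorem isIso_iterLiftToFinalSeq (n : ℕ) : IsIso (iterLiftToFinalSeq D n) := by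
  induction n with
  | zero => exact inferInstanceAs (IsIso (𝟙 PUnit))
  | succ n ih => exact inferInstanceAs (IsIso (F.map (iterLiftToFinalSeq D n)))

theorem cone_comp_iterLiftToFinalSeq {X : Type u} (γ : X ⟶ F.obj (T.obj X)) (n : ℕ) :
    (D.cone γ n).f ≫ iterLiftToFinalSeq D n = behaviour (D.determinizeHom γ).f n := by
  induction n with
  | zero => rfl
  | succ n ih =>
    change ((D.determinizeHom γ).f ≫ F.map (D.cone γ n).f) ≫ F.map (iterLiftToFinalSeq D n) =
      (D.determinizeHom γ).f ≫ F.map (behaviour (D.determinizeHom γ).f n)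
    refine (Category.assoc _ _ _).trans (congrArg (fun g => (D.determinizeHom γ).f ≫ g) ?_)
    exact (F.map_comp _ _).symm.trans (congrArg F.map ih)

variable (D) in
theorem cone_apply_eq_iff {X Y : Type u} (γ : X ⟶ F.obj (T.obj X)) (δ : Y ⟶ F.obj (T.obj Y))
    (n : ℕ) (v : T.obj X) (w : T.obj Y) :
    (D.cone γ n).f v = (D.cone δ n).f w ↔
      behaviour (D.determinizeHom γ).f n v = behaviour (D.determinizeHom δ).f n w := by
  rw [← cone_comp_iterLiftToFinalSeq, ← cone_comp_iterLiftToFinalSeq]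
  have := isIso_iterLiftToFinalSeq (D := D) n
  exact (((isIso_iff_bijective (iterLiftToFinalSeq D n)).1 this).1.eq_iff).symm

theorem behaviour_extensionSemantics {Z : Endofunctor.Coalgebra F} (hZ : IsTerminal Z)
    {X : Type u} (γ : X ⟶ F.obj (T.obj X)) (n : ℕ) (x : X) :
    behaviour Z.str n (D.extensionSemantics hZ γ x) =
      behaviour (D.determinizeHom γ).f n (T.η.app X x) :=
  ConcreteCategory.congr_hom (comp_behaviour (c := (D.determinizeHom γ).f)
    ((D.finalCoalgebraIsTerminal hZ).from (D.determinize γ)).f.f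
    (congrArg Monad.Algebra.Hom.f ((D.finalCoalgebraIsTerminal hZ).from (D.determinize γ)).h) n)
    (T.η.app X x)

/-- The extension semantics of a state is determined by the canonical cone. -/
theorem extensionSemantics_eq_iff [PreservesFilteredColimits F] {Z : Endofunctor.Coalgebra F}
    (hZ : IsTerminal Z) {X Y : Type u} (γ : X ⟶ F.obj (T.obj X)) (δ : Y ⟶ F.obj (T.obj Y))
    (x : X) (y : Y) :
    D.extensionSemantics hZ γ x = D.extensionSemantics hZ δ y ↔
      ∀ n, (D.cone γ n).f (T.η.app X x) = (D.cone δ n).f (T.η.app Y y) := by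
  simp only [cone_apply_eq_iff, ← behaviour_extensionSemantics hZ]
  exact ⟨fun h n => by rw [h], eq_of_behaviour_eq F hZ⟩

end FinalSequence

variable {L : T.Algebra ⥤ Endofunctor.Algebra D.lift}
  (adj : L ⊣ Endofunctor.Algebra.forget D.lift)

/-! ### Injectivity of the maps from the iterates to the free monad -/

section Mono

theorem injective_of_mono {A B : T.Algebra} (f : A ⟶ B) [Mono f] : Function.Injective f.f :=
  (mono_iff_injective _).1 (inferInstanceAs (Mono (T.forget.map f)))

/-- The iterates `F̂^n 1` are nonempty unless `F` is constantly empty. -/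
theorem nonempty_iterLift_one (h : Nonempty (F.obj PUnit.{u + 1})) (n : ℕ) :
    Nonempty ((D.iterLift n).obj (one T)).A := by
  induction n with
  | zero => exact ⟨PUnit.unit⟩
  | succ n ih =>
    obtain ⟨a⟩ := ih
    obtain ⟨t⟩ := h
    exact ⟨F.map (TypeCat.ofHom fun _ => a) t⟩

/-- In the induction step, `φ̂` is injective as a coproduct injection, and `F` preserves the
injectivity of `β̂^n` because its domain is nonempty: an element of `F̂^{n+1} 1` yields one of `F 1`. -/
theorem injective_beta [MonoCoprod T.Algebra] (n : ℕ) :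
    Function.Injective (beta adj n (one T)).f := by
  have : HasBinaryProducts T.Algebra :=
    hasLimitsOfShape_of_hasLimitsOfShape_createsLimitsOfShape T.forget
  obtain ⟨hc⟩ := nonempty_isColimit_of_adjunction adj (one T)
  induction n with
  | zero =>
    have : Mono (adj.unit.app (one T)) := MonoCoprod.binaryCofan_inr _ hc
    exact injective_of_mono (adj.unit.app (one T))
  | succ n ih =>
    have : Mono (L.obj (one T)).str := MonoCoprod.binaryCofan_inl _ hc
    intro v w hvw
    have hvw' : F.map (beta adj n (one T)).f v = F.map (beta adj n (one T)).f w :=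
      injective_of_mono (L.obj (one T)).str hvw
    have := nonempty_iterLift_one (D := D) ⟨F.map (bang _) v⟩ n
    exact map_injective_of_injective F _ ih hvw'

end Mono

/-! ### Traces -/

section Trace

section Kleisli

variable {M : Monad (Type u)}

theorem comp_kleisliStar_unit {X Y : Type u} (f : X ⟶ M.obj Y) :
    f ≫ kleisliStar M (M.η.app Y) = f := by
  exact (congrArg (f ≫ ·) (M.right_unit Y)).trans (Category.comp_id f)

theorem unit_comp_kleisliStar {X Y : Type u} (f : X ⟶ M.obj Y) :
    M.η.app X ≫ kleisliStar M f = f := by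
  have h : M.η.app X ≫ M.map f = f ≫ M.η.app (M.obj Y) := (M.η.naturality f).symm
  rw [kleisliStar, ← Category.assoc, h, Category.assoc, M.left_unit]
  exact Category.comp_id f

theorem kleisliStar_comp_kleisliStar {X Y W : Type u} (f : X ⟶ M.obj Y) (g : Y ⟶ M.obj W) :
    kleisliStar M (f ≫ kleisliStar M g) = kleisliStar M f ≫ kleisliStar M g := by
  have h : M.μ.app Y ≫ M.map g = M.map (M.map g) ≫ M.μ.app (M.obj W) :=
    (M.μ.naturality g).symm
  simp only [kleisliStar, Functor.map_comp, Category.assoc]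
  rw [M.assoc, ← Category.assoc (M.μ.app Y), h, Category.assoc]

/-- The iterations can also be computed by performing the new step first. -/
theorem iteration_succ' {G : Type u ⥤ Type u} (α : G ⟶ M.toFunctor) {X : Type u}
    (γ : X ⟶ G.obj X) (n : ℕ) :
    iteration α γ (n + 1) = (γ ≫ α.app X) ≫ kleisliStar M (iteration α γ n) := by
  induction n with
  | zero =>
    change M.η.app X ≫ kleisliStar M (γ ≫ α.app X) = (γ ≫ α.app X) ≫ kleisliStar M (M.η.app X)
    rw [unit_comp_kleisliStar, comp_kleisliStar_unit]
  | succ n ih =>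
    change iteration α γ (n + 1) ≫ kleisliStar M (γ ≫ α.app X) =
      (γ ≫ α.app X) ≫ kleisliStar M (iteration α γ n ≫ kleisliStar M (γ ≫ α.app X))
    rw [kleisliStar_comp_kleisliStar, ih, Category.assoc, Category.assoc]

end Kleisli

theorem unit_comp_determinizeHom {X : Type u} (γ : X ⟶ F.obj (T.obj X)) :
    T.η.app X ≫ (D.determinizeHom γ).f = γ := by
  change T.η.app X ≫ T.map γ ≫ D.ρ.app (T.obj X) ≫ F.map (T.μ.app X) = γ
  have h : T.η.app X ≫ T.map γ = γ ≫ T.η.app (F.obj (T.obj X)) := (T.η.naturality γ).symm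
  rw [← Category.assoc, h, Category.assoc, ← Category.assoc (T.η.app _), D.unit, ← F.map_comp,
    T.left_unit]
  exact (congrArg (γ ≫ ·) (F.map_id _)).trans (Category.comp_id γ)

/-- The Kleisli star of the monad of an adjunction is transposition. -/
theorem kleisliStar_toMonad {C : Type*} [Category* C] {L' : Type u ⥤ C} {R' : C ⥤ Type u}
    (adj' : L' ⊣ R') {X Y : Type u} (k : L'.obj X ⟶ L'.obj Y) :
    kleisliStar adj'.toMonad (adj'.homEquiv X (L'.obj Y) k) = R'.map k := by
  have h := (adj'.homEquiv X (L'.obj Y)).symm_apply_apply k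
  rw [Adjunction.homEquiv_counit] at h
  exact (R'.map_comp _ _).symm.trans (congrArg R'.map h)

/-- The Kleisli star of `M` extends a map in two steps, first to the free `T`-algebra and then to
the free `F̂`-algebra. -/
theorem kleisliStar_globalMonad {X Y : Type u}
    (k : L.obj (T.free.obj X) ⟶ L.obj (T.free.obj Y)) :
    kleisliStar (globalMonad adj) (T.η.app X ≫ (adj.unit.app (T.free.obj X) ≫ k.f).f) =
      k.f.f := by
  refine Eq.trans (congrArg _ ?_) (kleisliStar_toMonad (T.adj.comp adj) k)
  rw [Adjunction.homEquiv_unit]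
  rfl

/-- The extension to the free `T`-algebra of the `n`-th iteration of `γ` with respect to `α`. -/
def iterationHom {X : Type u} (γ : X ⟶ F.obj (T.obj X)) :
    ℕ → (T.free.obj X ⟶ (freeMonad adj).obj (T.free.obj X))
  | 0 => (freeMonad adj).η.app _
  | n + 1 => D.determinizeHom γ ≫ D.lift.map (iterationHom γ n) ≫ freeStr adj _

theorem unit_comp_iterationHom {X : Type u} (γ : X ⟶ F.obj (T.obj X)) (n : ℕ) :
    T.η.app X ≫ (iterationHom adj γ n).f = iteration (alpha adj) γ n := by
  induction n with
  | zero => rfl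
  | succ n ih =>
    let k := (adj.homEquiv (T.free.obj X) (L.obj (T.free.obj X))).symm (iterationHom adj γ n)
    have hk : adj.unit.app (T.free.obj X) ≫ k.f = iterationHom adj γ n := by
      have h := (adj.homEquiv (T.free.obj X) (L.obj (T.free.obj X))).apply_symm_apply
        (iterationHom adj γ n)
      rwa [Adjunction.homEquiv_unit] at h
    have hκ : (kappa adj).app (T.free.obj X) ≫ k.f =
        D.lift.map (iterationHom adj γ n) ≫ freeStr adj (T.free.obj X) := by
      refine (Category.assoc _ _ _).trans ((congrArg (D.lift.map _ ≫ ·) k.h.symm).trans ?_)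
      refine (Category.assoc _ _ _).symm.trans (congrArg (· ≫ freeStr adj (T.free.obj X)) ?_)
      exact (D.lift.map_comp _ _).symm.trans (congrArg D.lift.map hk)
    have hstar : kleisliStar (globalMonad adj) (iteration (alpha adj) γ n) = k.f.f := by
      rw [← ih, ← hk]
      exact kleisliStar_globalMonad adj k
    rw [iteration_succ', hstar]
    refine Eq.trans ?_ (Category.assoc γ _ _).symm
    refine Eq.trans ?_ (congrArg (fun g => γ ≫ g) (congrArg Monad.Algebra.Hom.f hκ).symm)
    refine (Category.assoc _ _ _).symm.trans ?_
    exact congrArg (· ≫ (D.lift.map (iterationHom adj γ n) ≫ freeStr adj (T.free.obj X)).f)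
      (unit_comp_determinizeHom γ)

/-- Postcomposition with `F̂^* !` turns the recursion for `iterationHom` into that for `γ̂_n`. -/
theorem iterationHom_comp_map_toOne {X : Type u} (γ : X ⟶ F.obj (T.obj X)) (n : ℕ) :
    iterationHom adj γ n ≫ (freeMonad adj).map (toOne (T.free.obj X)) = gammaHat adj γ n := by
  induction n with
  | zero => exact ((freeMonad adj).η.naturality (toOne (T.free.obj X))).symm
  | succ n ih =>
    change (D.determinizeHom γ ≫ D.lift.map (iterationHom adj γ n) ≫ freeStr adj _) ≫
      (freeMonad adj).map _ =
        (D.determinizeHom γ ≫ D.lift.map (D.cone γ n)) ≫ D.lift.map (beta adj n _) ≫ freeStr adj _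
    rw [Category.assoc, Category.assoc, Category.assoc, ← freeStr_naturality,
      ← Category.assoc (D.lift.map _), ← Category.assoc (D.lift.map _), ← D.lift.map_comp,
      ← D.lift.map_comp, ih]
    rfl

theorem map_bang_comp_collapse (X : Type u) :
    (globalMonad adj).map (bang X) ≫ collapse adj =
      ((freeMonad adj).map (toOne (T.free.obj X))).f :=
  congrArg Monad.Algebra.Hom.f
    ((freeMonad adj).map_comp (T.free.map (bang X)) (toOne (T.free.obj PUnit))).symm

theorem unit_comp_gammaHat {X : Type u} (γ : X ⟶ F.obj (T.obj X)) (n : ℕ) :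
    T.η.app X ≫ (gammaHat adj γ n).f =
      iteration (alpha adj) γ n ≫ (globalMonad adj).map (bang X) ≫ collapse adj := by
  rw [map_bang_comp_collapse, ← unit_comp_iterationHom, ← iterationHom_comp_map_toOne]
  rfl

/-- The members of the collapsed trace sequence, in terms of the canonical cone. -/
theorem collapse_traceSeq {X : Type u} (γ : X ⟶ F.obj (T.obj X)) (x : X) (n : ℕ) :
    collapse adj (traceSeq (alpha adj) γ x n) =
      (beta adj n (one T)).f ((D.cone γ n).f (T.η.app X x)) :=
  (ConcreteCategory.congr_hom (unit_comp_gammaHat adj γ n) x).symm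

end Trace

end DistribLaw

end TraceSem

theorem mainTheorem1 (F : Type u ⥤ Type u) [PreservesFilteredColimits F]
    (T : Monad (Type u)) [PreservesFilteredColimits T.toFunctor]
    (D : TraceSem.DistribLaw F T) :
    -- the final coalgebra and the free algebras exist
    HasTerminal (Endofunctor.Coalgebra F) ∧
    (Endofunctor.Algebra.forget D.lift).IsRightAdjoint ∧
    ∀ (Z : Endofunctor.Coalgebra F) (hZ : IsTerminal Z)
      (L : T.Algebra ⥤ Endofunctor.Algebra D.lift)
      (adj : L ⊣ Endofunctor.Algebra.forget D.lift),
      -- the concrete identity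
      (∀ (X : Type u) (γ : X ⟶ F.obj (T.obj X)) (n : ℕ),
        T.η.app X ≫ (TraceSem.DistribLaw.gammaHat adj γ n).f =
          TraceSem.iteration (TraceSem.DistribLaw.alpha adj) γ n ≫
            (TraceSem.DistribLaw.globalMonad adj).map (TraceSem.bang X) ≫
              TraceSem.DistribLaw.collapse adj) ∧
      -- equivalent states have identified trace sequences
      (∀ (X Y : Type u) (γ : X ⟶ F.obj (T.obj X)) (δ : Y ⟶ F.obj (T.obj Y)) (x : X) (y : Y),
        D.extensionSemantics hZ γ x = D.extensionSemantics hZ δ y →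
          ∀ n : ℕ,
            TraceSem.DistribLaw.collapse adj
                (TraceSem.traceSeq (TraceSem.DistribLaw.alpha adj) γ x n) =
              TraceSem.DistribLaw.collapse adj
                (TraceSem.traceSeq (TraceSem.DistribLaw.alpha adj) δ y n)) ∧
      -- the equivalence, when coproduct injections are monic in the category of `T`-algebras
      (MonoCoprod T.Algebra →
        ∀ (X Y : Type u) (γ : X ⟶ F.obj (T.obj X)) (δ : Y ⟶ F.obj (T.obj Y)) (x : X) (y : Y),
          D.extensionSemantics hZ γ x = D.extensionSemantics hZ δ y ↔
            ∀ n : ℕ,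
              TraceSem.DistribLaw.collapse adj
                  (TraceSem.traceSeq (TraceSem.DistribLaw.alpha adj) γ x n) =
                TraceSem.DistribLaw.collapse adj
                  (TraceSem.traceSeq (TraceSem.DistribLaw.alpha adj) δ y n)) := by
  refine ⟨(TraceSem.Behaviours.coalgebraIsTerminal F).hasTerminal,
    TraceSem.isRightAdjoint_forget D, fun Z hZ L adj => ?_⟩
  have sound (X Y : Type u) (γ : X ⟶ F.obj (T.obj X)) (δ : Y ⟶ F.obj (T.obj Y)) (x : X) (y : Y)
      (h : D.extensionSemantics hZ γ x = D.extensionSemantics hZ δ y) (n : ℕ) :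
      TraceSem.DistribLaw.collapse adj
          (TraceSem.traceSeq (TraceSem.DistribLaw.alpha adj) γ x n) =
        TraceSem.DistribLaw.collapse adj
          (TraceSem.traceSeq (TraceSem.DistribLaw.alpha adj) δ y n) := by
    rw [TraceSem.DistribLaw.collapse_traceSeq, TraceSem.DistribLaw.collapse_traceSeq,
      (TraceSem.DistribLaw.extensionSemantics_eq_iff hZ γ δ x y).1 h n]
  refine ⟨fun X γ n => TraceSem.DistribLaw.unit_comp_gammaHat adj γ n, sound, ?_⟩
  intro _ X Y γ δ x y
  refine ⟨sound X Y γ δ x y, fun h => ?_⟩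
  refine (TraceSem.DistribLaw.extensionSemantics_eq_iff hZ γ δ x y).2 fun n => ?_
  have hn := h n
  rw [TraceSem.DistribLaw.collapse_traceSeq, TraceSem.DistribLaw.collapse_traceSeq] at hn
  exact TraceSem.DistribLaw.injective_beta adj n hn
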